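/- Let $S^1=\{z\in\mathbb C:|z|=1\}$, parametrized by $t\mapsto e^{it}$, $t\in[0,2\pi)$, let $\mathcal F$ be the set of integrable fuzzy subsets of $S^1$, i.e. of Lebesgue-integrable functions $f:S^1\to[0,1]$, and put $$c_k(f)=\frac1{2\pi}\int_0^{2\pi}f(e^{it})\,e^{ikt}\,dt\qquad(k\in\mathbb Z).$$ For $n\ge 1$ let $\mathcal G_n$ (the crisp subsets of order $n$) be the set of characteristic functions of the sets $\bigcup_{r=1}^n\{e^{it}:\xi_r\le t\le\eta_r\}$, where $0=\xi_1<\eta_1<\xi_2<\eta_2<\dots<\xi_n<\eta_n<2\pi$. For every $f\in\mathcal F$ there exists a sequence $(\chi_n)_{n\ge1}$ such that, for every $n\ge 1$ for which $f$ is not almost everywhere equal to the constant $1$ or to the characteristic function of a union of fewer than $n$ closed arcs of $S^1$ (in any position; the empty union is allowed), $$\chi_n\in\mathcal G_n\qquad\text{and}\qquad c_k(\chi_n)=c_k(f)\quad\text{for } k=0,\dots,n-1.$$ In particular, if $f$ is not almost everywhere equal to the characteristic function of a finite union of arcs, this holds for every $n\ge1$. -/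

import Mathlib

/-- The integrable fuzzy subsets of the unit circle: the summable functions on the circle
(parametrized by `t ↦ exp (i t)`, `t ∈ [0, 2π)`) with values in `[0, 1]`. -/
def FuzzySubsets : Set (Circle → ℝ) :=
  {f | (∀ z, f z ∈ Set.Icc (0 : ℝ) 1) ∧
    MeasureTheory.IntegrableOn (fun t : ℝ => f (Circle.exp t)) (Set.Ico 0 (2 * Real.pi))}

/-- The Fourier coefficient `c_k(f) = (1 / 2π) ∫₀^{2π} f(t) e^{ikt} dt`. -/
noncomputable def circleCoeff (f : Circle → ℝ) (k : ℤ) : ℂ :=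
  (1 / (2 * Real.pi) : ℂ) *
    ∫ t in (0 : ℝ)..(2 * Real.pi), (f (Circle.exp t) : ℂ) * Complex.exp (Complex.I * k * t)

/-- The union of the `n` closed arcs `{exp (i t) : ξ r ≤ t ≤ η r}`. -/
def arcUnion {n : ℕ} (ξ η : Fin n → ℝ) : Set Circle :=
  ⋃ r, Circle.exp '' Set.Icc (ξ r) (η r)

/-- The crisp subsets of order `n`: characteristic functions of the unions of the arcs
`[ξ r, η r]`, where `0 = ξ 1 < η 1 < ξ 2 < η 2 < ⋯ < ξ n < η n < 2π`. -/
def CrispSubsets (n : ℕ) : Set (Circle → ℝ) :=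
  {χ | ∃ ξ η : Fin n → ℝ,
    (∀ r, r.val = 0 → ξ r = 0) ∧ (∀ r, ξ r < η r) ∧ (∀ r s, r < s → η r < ξ s) ∧
    (∀ r, η r < 2 * Real.pi) ∧ χ = (arcUnion ξ η).indicator 1}

/-- Two functions on the circle agree almost everywhere. -/
def CircleAEEq (f g : Circle → ℝ) : Prop :=
  ∀ᵐ t ∂(MeasureTheory.volume.restrict (Set.Ico (0 : ℝ) (2 * Real.pi))),
    f (Circle.exp t) = g (Circle.exp t)

/-- Up to a null set, `f` is the characteristic function of the whole circle, or of a union of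
fewer than `n` arcs (in any position; the empty union is allowed). -/
def IsArcUnionOfFewerThan (n : ℕ) (f : Circle → ℝ) : Prop :=
  CircleAEEq f 1 ∨
    ∃ m < n, ∃ a b : Fin m → ℝ, CircleAEEq f ((arcUnion a b).indicator 1)

/-! The proof is a bang-bang argument by convex duality. Put `m = n - 1` and F(t) = f(e^{it}). Among
the functions h with values in [0, 1] and the same moments as F against trigonometric polynomials of
degree at most `m`, consider minimizing ∫ h(t) t dt. The dual problem minimizes J(v) = ∫ F v +
max(0, -(t + v)) over such polynomials v, a finite-dimensional space. The recession function of J is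
K(v) = ∫ F v⁺ + (1 - F) v⁻ ≥ 0, and K(v) = 0 forces F to be the indicator of {v < 0} almost
everywhere. A nonzero v has at most 2m zeros per period, so f would then be an excluded function
(`isArcUnionOfFewerThan_of_dualFunctional_le`). Otherwise J is coercive and has a minimizer q, and
stationarity says that F and the indicator of {t + q < 0} have the same moments
(`exists_moments_eq`).

It remains to count sign intervals of g(t) = t + q(t) on [0, 2π]. By Rolle g has at most 2m + 1
zeros (`id_add_trigPoly_card_zeros_le`), hence at most 2m + 2 sign intervals. With fewer, some
nonzero trigonometric polynomial r has the sign of g (`AlternatesOn.exists_trigPoly`), and equality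
of moments gives K(r) = 0, which is impossible. So there are exactly 2m + 2 intervals. Since g(2π) =
g(0) + 2π, the first is negative and the last positive: there are `m + 1` arcs, the first starting
at 0. The cost t, with its jump at the base point, is what pins an endpoint there. -/

open Polynomial MeasureTheory
open scoped BoundedContinuousFunction

/-! ### Trigonometric polynomials: dimension, zeros, derivatives, examples. -/

/-- The real trigonometric polynomials of degree at most `m`, as bounded continuous functions. -/
def trigPoly (m : ℕ) : Submodule ℝ (ℝ →ᵇ ℝ) where
  carrier := {v | ∃ p : ℂ[X], p.natDegree ≤ 2 * m ∧
    ∀ t : ℝ, (v t : ℂ) * Complex.exp (t * Complex.I) ^ m = p.eval (Complex.exp (t * Complex.I))}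
  add_mem' := by
    rintro v w ⟨p, hp, hpe⟩ ⟨q, hq, hqe⟩
    refine ⟨p + q, (natDegree_add_le _ _).trans (max_le hp hq), fun t => ?_⟩
    rw [eval_add, ← hpe, ← hqe]
    simp [add_mul]
  zero_mem' := ⟨0, by simp, by simp⟩
  smul_mem' := by
    rintro c v ⟨p, hp, hpe⟩
    refine ⟨C (c : ℂ) * p, (natDegree_C_mul_le _ _).trans hp, fun t => ?_⟩
    rw [eval_mul, ← hpe]
    simp [mul_assoc]

/-- Multiplication by the nonvanishing e^{imt} embeds the space into the range of the linear map
sending 2m + 1 complex coefficients to a function. -/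
instance finiteDimensional_trigPoly (m : ℕ) : FiniteDimensional ℝ (trigPoly m) := by
  let E : (Fin (2 * m + 1) → ℂ) →ₗ[ℝ] (ℝ → ℂ) :=
    { toFun := fun c t => ∑ j, c j * Complex.exp (t * Complex.I) ^ (j : ℕ)
      map_add' := fun c d => by
        ext t
        simp [add_mul, Finset.sum_add_distrib]
      map_smul' := fun a c => by
        ext t
        simp [Finset.mul_sum, mul_assoc] }
  let M : trigPoly m →ₗ[ℝ] (ℝ → ℂ) :=
    { toFun := fun v t => ((v : ℝ →ᵇ ℝ) t : ℂ) * Complex.exp (t * Complex.I) ^ m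
      map_add' := fun v w => by
        ext t
        simp [add_mul]
      map_smul' := fun a c => by
        ext t
        simp [mul_assoc] }
  have hM : Function.Injective M := by
    intro v w h
    ext t
    have := congrFun h t
    simpa [M, Complex.exp_ne_zero] using this
  have hr : ∀ v, M v ∈ LinearMap.range E := by
    rintro ⟨v, p, hp, hpe⟩
    refine ⟨fun j => p.coeff j, ?_⟩
    ext t
    have := hpe t
    rw [eval_eq_sum_range' (Nat.lt_succ_of_le hp), Finset.sum_range] at this
    exact this.symm
  exact Module.Finite.of_injective (M.codRestrict (LinearMap.range E) hr)
    (fun v w h => hM (congrArg Subtype.val h))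

theorem exp_mul_I_injOn :
    Set.InjOn (fun t : ℝ => Complex.exp (t * Complex.I)) (Set.Ico 0 (2 * Real.pi)) := by
  intro x hx y hy h
  obtain ⟨k, hk⟩ := Complex.exp_eq_exp_iff_exists_int.1 h
  have hk' : x = y + k * (2 * Real.pi) := by
    have := congrArg Complex.im hk
    simpa using this
  have hpi := Real.pi_pos
  have h1 : (k : ℝ) < 1 := by
    by_contra hc
    push Not at hc
    nlinarith [hx.2, hy.1]
  have h2 : (-1 : ℝ) < k := by
    by_contra hc
    push Not at hc
    nlinarith [hx.1, hy.2]
  have h3 : k = 0 := by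
    have : k < 1 := by exact_mod_cast h1
    have : -1 < k := by exact_mod_cast h2
    omega
  simpa [h3] using hk'

/-- A nonzero trigonometric polynomial has at most `2 * m` zeros in a period. -/
theorem card_zeros_le {m : ℕ} {g : ℝ → ℝ} {p : ℂ[X]} (hp : p.natDegree ≤ 2 * m)
    (hg : ∀ t : ℝ, (g t : ℂ) * Complex.exp (t * Complex.I) ^ m =
      p.eval (Complex.exp (t * Complex.I)))
    (h0 : ∃ t, g t ≠ 0) (S : Finset ℝ) (hS : ∀ x ∈ S, x ∈ Set.Ico 0 (2 * Real.pi) ∧ g x = 0) :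
    S.card ≤ 2 * m := by
  have hp0 : p ≠ 0 := by
    rintro rfl
    obtain ⟨t, ht⟩ := h0
    have := hg t
    simp [Complex.exp_ne_zero, ht] at this
  -- The half-open period makes the zeros distinct points of the circle, hence distinct roots of
  -- `p`.
  calc S.card = (S.image (fun t : ℝ => Complex.exp (t * Complex.I))).card :=
        (Finset.card_image_of_injOn (exp_mul_I_injOn.mono fun x hx => (hS x hx).1)).symm
    _ ≤ p.natDegree := by
        refine card_le_degree_of_subset_roots fun z hz => ?_
        obtain ⟨t, ht, rfl⟩ := Finset.mem_image.1 hz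
        rw [mem_roots hp0, IsRoot.def, ← hg, (hS t ht).2]
        simp
    _ ≤ 2 * m := hp

theorem trigPoly_card_zeros_le {m : ℕ} {v : ℝ →ᵇ ℝ} (hv : v ∈ trigPoly m) (h0 : v ≠ 0)
    (S : Finset ℝ) (hS : ∀ x ∈ S, x ∈ Set.Ico 0 (2 * Real.pi) ∧ v x = 0) : S.card ≤ 2 * m := by
  obtain ⟨p, hp, hpe⟩ := hv
  refine card_zeros_le hp hpe ?_ S hS
  by_contra h
  push Not at h
  exact h0 (by ext t; simp [h t])

theorem trigPoly_add_two_pi {m : ℕ} {v : ℝ →ᵇ ℝ} (hv : v ∈ trigPoly m) (t : ℝ) :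
    v (t + 2 * Real.pi) = v t := by
  obtain ⟨p, -, hpe⟩ := hv
  have h : Complex.exp (((t + 2 * Real.pi : ℝ) : ℂ) * Complex.I) =
      Complex.exp (t * Complex.I) := by
    rw [← Complex.exp_periodic (t * Complex.I)]
    push_cast
    ring_nf
  have h1 := hpe (t + 2 * Real.pi)
  rw [h, ← hpe t] at h1
  exact_mod_cast mul_right_cancel₀ (pow_ne_zero _ (Complex.exp_ne_zero _)) h1

/-- The derivative of a trigonometric polynomial is one of the same degree. -/
theorem trigPoly_hasDerivAt {m : ℕ} {v : ℝ →ᵇ ℝ} (hv : v ∈ trigPoly m) :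
    ∃ (w : ℝ → ℝ) (p : ℂ[X]), p.natDegree ≤ 2 * m ∧ (∀ t, HasDerivAt v (w t) t) ∧
      ∀ t : ℝ, (w t : ℂ) * Complex.exp (t * Complex.I) ^ m =
        p.eval (Complex.exp (t * Complex.I)) := by
  obtain ⟨p, hp, hpe⟩ := hv
  have he : ∀ t : ℝ, HasDerivAt (fun t : ℝ => Complex.exp (t * Complex.I))
      (Complex.exp (t * Complex.I) * Complex.I) t := fun t => by
    simpa using ((hasDerivAt_id t).ofReal_comp.mul_const Complex.I).cexp
  have hG : ∀ t : ℝ, (v t : ℂ) =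
      p.eval (Complex.exp (t * Complex.I)) / Complex.exp (t * Complex.I) ^ m := fun t => by
    rw [← hpe, mul_div_cancel_right₀ _ (pow_ne_zero _ (Complex.exp_ne_zero _))]
  have hpd : ∀ t : ℝ, HasDerivAt (fun t : ℝ => p.eval (Complex.exp (t * Complex.I)))
      ((derivative p).eval (Complex.exp (t * Complex.I)) *
        (Complex.exp (t * Complex.I) * Complex.I)) t := fun t =>
    (p.hasDerivAt (Complex.exp (t * Complex.I))).comp (h₂ := fun z => p.eval z) t (he t)
  have hd : ∀ t : ℝ, ∃ w : ℂ, HasDerivAt (fun t : ℝ => (v t : ℂ)) w t := fun t => by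
    simp_rw [hG]
    exact ⟨_, (hpd t).div ((he t).pow m) (pow_ne_zero _ (Complex.exp_ne_zero _))⟩
  choose w hw using hd
  have hre : ∀ t, HasDerivAt v (w t).re t := fun t => by
    exact Complex.reCLM.hasFDerivAt.comp_hasDerivAt t (hw t)
  have hwr : ∀ t, ((w t).re : ℂ) = w t := fun t => (hre t).ofReal_comp.unique (hw t)
  -- With z = e^{it}, differentiating v z^m = p(z) gives w z^m = i z p'(z) - i m p(z).
  refine ⟨fun t => (w t).re, C Complex.I * X * derivative p - C (m * Complex.I) * p, ?_, hre, ?_⟩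
  · refine (natDegree_sub_le _ _).trans (max_le ?_ ((natDegree_C_mul_le _ _).trans hp))
    rw [mul_assoc]
    refine (natDegree_C_mul_le _ _).trans ?_
    by_cases h : p.natDegree = 0
    · rw [natDegree_eq_zero.1 h |>.choose_spec.symm]
      simp
    · refine natDegree_mul_le.trans ?_
      have := natDegree_derivative_lt h
      have := natDegree_X_le (R := ℂ)
      omega
  · intro t
    have h2 := (hw t).mul ((he t).pow m)
    have h3 := h2.unique ((hpd t).congr_of_eventuallyEq (Filter.Eventually.of_forall fun s => hpe s))
    have h4 : (m : ℂ) * Complex.exp (t * Complex.I) ^ (m - 1) * Complex.exp (t * Complex.I) =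
        m * Complex.exp (t * Complex.I) ^ m := by
      cases m with
      | zero => simp
      | succ k => simp [pow_succ, mul_assoc]
    simp only [Pi.pow_apply] at h3
    simp only [hwr, eval_sub, eval_mul, eval_C, eval_X]
    rw [← hpe t]
    linear_combination h3 - (v t : ℂ) * Complex.I * h4

theorem cos_mem_trigPoly {m k : ℕ} (hk : k ≤ m) :
    ∃ v ∈ trigPoly m, ∀ t, v t = Real.cos (k * t) := by
  refine ⟨BoundedContinuousFunction.ofNormedAddCommGroup (fun t => Real.cos (k * t))
    (by fun_prop) 1 (fun t => Real.abs_cos_le_one _), ⟨C (1 / 2) * (X ^ (m + k) + X ^ (m - k)),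
    (natDegree_C_mul_le _ _).trans ((natDegree_add_le _ _).trans (max_le ?_ ?_)), fun t => ?_⟩,
    fun t => rfl⟩
  · simp; omega
  · simp; omega
  · obtain ⟨d, rfl⟩ := Nat.exists_eq_add_of_le hk
    have h1 : Complex.exp (t * Complex.I) ^ k * Complex.exp (-(t * Complex.I)) ^ k = 1 := by
      rw [← mul_pow, ← Complex.exp_add]; simp
    have h2 : Complex.cos (k * t) =
        (Complex.exp (t * Complex.I) ^ k + Complex.exp (-(t * Complex.I)) ^ k) / 2 := by
      rw [Complex.cos, ← Complex.exp_nat_mul, ← Complex.exp_nat_mul]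
      ring_nf
    simp only [BoundedContinuousFunction.coe_ofNormedAddCommGroup, Complex.ofReal_cos, Complex.ofReal_mul,
      Complex.ofReal_natCast, h2, eval_mul, eval_add, eval_pow, eval_X, eval_C,
      Nat.add_sub_cancel_left, pow_add]
    linear_combination Complex.exp (t * Complex.I) ^ d / 2 * h1

theorem sin_mem_trigPoly {m k : ℕ} (hk : k ≤ m) :
    ∃ v ∈ trigPoly m, ∀ t, v t = Real.sin (k * t) := by
  refine ⟨BoundedContinuousFunction.ofNormedAddCommGroup (fun t => Real.sin (k * t))
    (by fun_prop) 1 (fun t => Real.abs_sin_le_one _),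
    ⟨C (Complex.I / 2) * (X ^ (m - k) - X ^ (m + k)),
    (natDegree_C_mul_le _ _).trans ((natDegree_sub_le _ _).trans (max_le ?_ ?_)), fun t => ?_⟩,
    fun t => rfl⟩
  · simp; omega
  · simp; omega
  · obtain ⟨d, rfl⟩ := Nat.exists_eq_add_of_le hk
    have h1 : Complex.exp (t * Complex.I) ^ k * Complex.exp (-(t * Complex.I)) ^ k = 1 := by
      rw [← mul_pow, ← Complex.exp_add]; simp
    have h2 : Complex.sin (k * t) =
        (Complex.exp (-(t * Complex.I)) ^ k - Complex.exp (t * Complex.I) ^ k) *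
          Complex.I / 2 := by
      rw [Complex.sin, ← Complex.exp_nat_mul, ← Complex.exp_nat_mul]
      ring_nf
    simp only [BoundedContinuousFunction.coe_ofNormedAddCommGroup, Complex.ofReal_sin, Complex.ofReal_mul,
      Complex.ofReal_natCast, h2, eval_mul, eval_sub, eval_pow, eval_X, eval_C,
      Nat.add_sub_cancel_left, pow_add]
    linear_combination Complex.I * Complex.exp (t * Complex.I) ^ d / 2 * h1

/-- A product of `2 * l` functions `sin ((t - a) / 2)` is a trigonometric polynomial of
degree `l`. -/
theorem prod_sin_mem_trigPoly {m l : ℕ} (hl : l ≤ m) (S : Finset ℕ) (hS : S.card = 2 * l)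
    (a : ℕ → ℝ) : ∃ v ∈ trigPoly m, ∀ t, v t = ∏ j ∈ S, Real.sin ((t - a j) / 2) := by
  refine ⟨BoundedContinuousFunction.ofNormedAddCommGroup
    (fun t => ∏ j ∈ S, Real.sin ((t - a j) / 2)) (by fun_prop) 1 (fun t => ?_),
    ⟨X ^ (m - l) * ∏ j ∈ S, (C (Complex.exp (-(a j / 2 * Complex.I)) / (2 * Complex.I)) * X -
      C (Complex.exp (a j / 2 * Complex.I) / (2 * Complex.I))), ?_, fun t => ?_⟩, fun t => rfl⟩
  · rw [Real.norm_eq_abs, Finset.abs_prod]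
    exact Finset.prod_le_one (fun _ _ => abs_nonneg _) fun _ _ => Real.abs_sin_le_one _
  · refine natDegree_mul_le.trans ?_
    have h1 : (∏ j ∈ S, (C (Complex.exp (-(a j / 2 * Complex.I)) / (2 * Complex.I)) * X -
      C (Complex.exp (a j / 2 * Complex.I) / (2 * Complex.I)))).natDegree ≤ S.card * 1 := by
      refine (natDegree_prod_le _ _).trans ?_
      rw [← smul_eq_mul]
      refine Finset.sum_le_card_nsmul _ _ _ fun j _ => ?_
      exact natDegree_sub_C.trans_le ((natDegree_C_mul_le _ _).trans natDegree_X_le)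
    rw [natDegree_X_pow]
    omega
  -- Each half-angle sine times e^{it/2} is affine in e^{it}; an even number 2l of factors is needed
  -- so that the powers of e^{it/2} combine to e^{ilt}.
  · have key : ∀ j, ((Real.sin ((t - a j) / 2) : ℝ) : ℂ) * Complex.exp (t / 2 * Complex.I) =
        Complex.exp (-(a j / 2 * Complex.I)) / (2 * Complex.I) * Complex.exp (t * Complex.I) -
          Complex.exp (a j / 2 * Complex.I) / (2 * Complex.I) := fun j => by
      push_cast
      rw [Complex.sin]
      have e1 : Complex.exp (-((t - a j) / 2 : ℂ) * Complex.I) *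
          Complex.exp (t / 2 * Complex.I) = Complex.exp (a j / 2 * Complex.I) := by
        rw [← Complex.exp_add]; ring_nf
      have e2 : Complex.exp ((t - a j) / 2 * Complex.I) *
          Complex.exp (t / 2 * Complex.I) =
          Complex.exp (-(a j / 2 * Complex.I)) * Complex.exp (t * Complex.I) := by
        rw [← Complex.exp_add, ← Complex.exp_add]; ring_nf
      have hI : Complex.I / 2 = - (1 / (2 * Complex.I)) := by
        field_simp
        simp
      linear_combination Complex.I / 2 * (e1 - e2) + hI * (Complex.exp (a j / 2 * Complex.I) -
        Complex.exp (-(a j / 2 * Complex.I)) * Complex.exp (t * Complex.I))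
    have h2 : Complex.exp (t * Complex.I) ^ l = Complex.exp (t / 2 * Complex.I) ^ S.card := by
      rw [hS, pow_mul, ← Complex.exp_nat_mul _ 2]
      congr 2
      push_cast
      ring
    have h3 : Complex.exp (t * Complex.I) ^ m =
        Complex.exp (t * Complex.I) ^ (m - l) * Complex.exp (t * Complex.I) ^ l := by
      rw [← pow_add, Nat.sub_add_cancel hl]
    simp only [BoundedContinuousFunction.coe_ofNormedAddCommGroup, eval_mul, eval_pow, eval_X, eval_prod, eval_sub, eval_C,
      ← key, Finset.prod_mul_distrib, Finset.prod_const, ← h2, h3, Complex.ofReal_prod]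
    ring

/-! ### Sign changes and alternating partitions. -/

/-- `g` alternates in sign on the consecutive intervals of the partition
`t 0 < t 1 < ⋯ < t N`, with sign `s` on the first one. -/
structure AlternatesOn (g : ℝ → ℝ) (a b : ℝ) (N : ℕ) (t : ℕ → ℝ) (s : ℝ) : Prop where
  strictMono : StrictMono t
  left : t 0 = a
  right : t N = b
  pos : 0 < N
  sign : s = 1 ∨ s = -1
  nonneg : ∀ i < N, ∀ x ∈ Set.Icc (t i) (t (i + 1)), 0 ≤ s * (-1) ^ i * g x

theorem exists_sign_of_ne_zero {g : ℝ → ℝ} (hg : Continuous g) {a b : ℝ} (hab : a < b)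
    (h : ∀ x ∈ Set.Ioo a b, g x ≠ 0) :
    ∃ s : ℝ, (s = 1 ∨ s = -1) ∧ ∀ x ∈ Set.Icc a b, 0 ≤ s * g x := by
  have hIcc : ∀ s : ℝ, (∀ x ∈ Set.Ioo a b, 0 ≤ s * g x) → ∀ x ∈ Set.Icc a b, 0 ≤ s * g x := by
    intro s hs
    rw [← closure_Ioo hab.ne]
    exact closure_minimal hs (isClosed_le continuous_const (continuous_const.mul hg))
  have hpc : IsPreconnected (Set.Ioo a b) := isPreconnected_Ioo
  by_cases hp : ∀ x ∈ Set.Ioo a b, 0 ≤ g x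
  · exact ⟨1, Or.inl rfl, hIcc 1 (by simpa using hp)⟩
  · push Not at hp
    obtain ⟨y, hy, hy0⟩ := hp
    refine ⟨-1, Or.inr rfl, hIcc _ fun x hx => ?_⟩
    by_contra hc
    have hx0 : 0 ≤ g x := by linarith
    obtain ⟨z, hz, hz0⟩ := hpc.intermediate_value hy hx hg.continuousOn ⟨hy0.le, hx0⟩
    exact h z hz hz0

/-- If `σ` is already the sign of the last interval, that interval is enlarged up to `b`; otherwise
a new one is appended. Zeros without a sign change thus leave no partition point. -/
theorem AlternatesOn.extend {g : ℝ → ℝ} {a z b : ℝ} {N : ℕ} {t : ℕ → ℝ} {s σ : ℝ}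
    (h : AlternatesOn g a z N t s) (hzb : z < b) (hσ : σ = 1 ∨ σ = -1)
    (hpos : ∀ x ∈ Set.Icc z b, 0 ≤ σ * g x) : ∃ N' t', AlternatesOn g a b N' t' s := by
  obtain ⟨M, hM, hM0, hMs⟩ : ∃ M, (M = N ∨ M = N + 1) ∧ 0 < M ∧ σ = s * (-1) ^ (M - 1) := by
    obtain ⟨k, rfl⟩ := Nat.exists_eq_succ_of_ne_zero h.pos.ne'
    rcases hσ with rfl | rfl <;> rcases h.sign with rfl | rfl <;>
      rcases neg_one_pow_eq_or ℝ k with hk | hk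
    all_goals first
      | refine ⟨k + 1, Or.inl rfl, k.succ_pos, ?_⟩
        rw [Nat.add_sub_cancel, hk]
        norm_num
        done
      | refine ⟨k + 2, Or.inr rfl, (k + 1).succ_pos, ?_⟩
        rw [show k + 2 - 1 = k + 1 from rfl, pow_succ, hk]
        norm_num
  have htb : ∀ i < M, t i < b := fun i hi =>
    (h.strictMono.monotone (show i ≤ N by omega)).trans_lt (h.right ▸ hzb)
  -- Values beyond index `M` only keep the sequence strictly increasing on all of ℕ.
  refine ⟨M, fun i => if i < M then t i else b + ((i : ℝ) - M), ?_, ?_, ?_, hM0, h.sign, ?_⟩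
  · refine strictMono_nat_of_lt_succ fun i => ?_
    by_cases h1 : i + 1 < M
    · simpa [h1, show i < M by omega] using h.strictMono (Nat.lt_succ_self i)
    · by_cases h2 : i < M
      · have h3 : ((i + 1 : ℕ) : ℝ) = M := by exact_mod_cast (by omega : i + 1 = M)
        simp only [h1, h2, if_true, if_false, h3]
        linarith [htb i h2]
      · simp only [h1, h2, if_false]
        push_cast
        linarith
  · simp [hM0, h.left]
  · simp
  · intro i hi x hx
    simp only [hi, if_true] at hx
    by_cases h1 : i + 1 < M
    · simp only [h1, if_true] at hx
      exact h.nonneg i (by omega) x hx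
    · have h2 : i + 1 = M := by omega
      have h3 : ((i + 1 : ℕ) : ℝ) = M := by exact_mod_cast h2
      simp only [h1, if_false, h3, sub_self, add_zero] at hx
      have h4 : i = M - 1 := by omega
      by_cases hxz : z ≤ x
      · have := hpos x ⟨hxz, hx.2⟩
        rwa [hMs, ← h4] at this
      · push Not at hxz
        rcases hM with rfl | rfl
        · exact h.nonneg i hi x ⟨hx.1, by rw [h2, h.right]; exact hxz.le⟩
        · have : i = N := by omega
          rw [this, h.right] at hx
          exact absurd hx.1 (not_le.2 hxz)

/-- A continuous function with finitely many zeros has an alternating partition. -/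
theorem exists_alternatesOn {g : ℝ → ℝ} (hg : Continuous g) {a b : ℝ} (hab : a < b)
    (hfin : {x ∈ Set.Ioo a b | g x = 0}.Finite) : ∃ N t s, AlternatesOn g a b N t s := by
  induction hk : {x ∈ Set.Ioo a b | g x = 0}.ncard using Nat.strong_induction_on
    generalizing b with
  | _ k ih =>
    by_cases hne : {x ∈ Set.Ioo a b | g x = 0}.Nonempty
    -- Split at the largest zero: to its right the sign is constant, to its left there are fewer
    -- zeros.
    · obtain ⟨z, ⟨hz, hgz⟩, hmax⟩ := Set.exists_max_image _ id hfin hne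
      have hss : {x ∈ Set.Ioo a z | g x = 0} ⊂ {x ∈ Set.Ioo a b | g x = 0} := by
        refine ⟨fun x hx => ⟨⟨hx.1.1, hx.1.2.trans hz.2⟩, hx.2⟩, fun hc => ?_⟩
        exact lt_irrefl z (hc ⟨hz, hgz⟩).1.2
      obtain ⟨N, t, s, h⟩ := ih _ (hk ▸ Set.ncard_lt_ncard hss hfin) hz.1
        (hfin.subset hss.1) rfl
      obtain ⟨σ, hσ, hpos⟩ := exists_sign_of_ne_zero hg hz.2 fun x hx hx0 =>
        absurd (hmax x ⟨⟨hz.1.trans hx.1, hx.2⟩, hx0⟩) (not_le.2 hx.1)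
      obtain ⟨N', t', h'⟩ := h.extend hz.2 hσ hpos
      exact ⟨N', t', s, h'⟩
    · obtain ⟨s, hs, hpos⟩ := exists_sign_of_ne_zero hg hab fun x hx hx0 => hne ⟨x, hx, hx0⟩
      refine ⟨1, fun i => a + i * (b - a), s, ?_, by simp, by simp, one_pos, hs, ?_⟩
      · refine strictMono_nat_of_lt_succ fun i => ?_
        push_cast
        linarith
      · intro i hi x hx
        obtain rfl : i = 0 := by omega
        simpa using hpos x (by simpa using hx)

namespace AlternatesOn

variable {g : ℝ → ℝ} {a b : ℝ} {N : ℕ} {t : ℕ → ℝ} {s : ℝ}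

theorem eq_zero (h : AlternatesOn g a b N t s) {i : ℕ} (h0 : 0 < i) (hi : i < N) :
    g (t i) = 0 := by
  obtain ⟨k, rfl⟩ := Nat.exists_eq_succ_of_ne_zero h0.ne'
  have hm := h.strictMono.monotone
  have h1 := h.nonneg k (by omega) (t (k + 1)) ⟨hm (by omega), le_rfl⟩
  have h2 := h.nonneg (k + 1) hi (t (k + 1)) ⟨le_rfl, hm (by omega)⟩
  rcases h.sign with rfl | rfl <;> rcases neg_one_pow_eq_or ℝ k with hk | hk <;>
    simp only [pow_succ, hk] at h1 h2 <;> simp only [Nat.succ_eq_add_one] <;> linarith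

/-- The interior points of an alternating partition are zeros. -/
theorem pred_le (h : AlternatesOn g a b N t s) {k : ℕ}
    (hk : ∀ S : Finset ℝ, (∀ x ∈ S, x ∈ Set.Ioo a b ∧ g x = 0) → S.card ≤ k) : N ≤ k + 1 := by
  have h1 := hk ((Finset.Ioo 0 N).image t) fun x hx => by
    obtain ⟨i, hi, rfl⟩ := Finset.mem_image.1 hx
    rw [Finset.mem_Ioo] at hi
    exact ⟨⟨h.left ▸ h.strictMono hi.1, h.right ▸ h.strictMono hi.2⟩, h.eq_zero hi.1 hi.2⟩
  rw [Finset.card_image_of_injective _ h.strictMono.injective, Nat.card_Ioo] at h1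
  omega

theorem exists_mem (h : AlternatesOn g a b N t s) {x : ℝ} (hx : x ∈ Set.Ico a b) :
    ∃ i < N, x ∈ Set.Ico (t i) (t (i + 1)) := by
  have hex : ∃ j, x < t j := ⟨N, h.right ▸ hx.2⟩
  classical
  have h1 := Nat.find_spec hex
  have h0 : Nat.find hex ≠ 0 := by
    intro h0
    rw [h0, h.left] at h1
    exact absurd hx.1 (not_le.2 h1)
  have hN : Nat.find hex ≤ N := Nat.find_min' hex (h.right ▸ hx.2)
  obtain ⟨i, hi⟩ := Nat.exists_eq_succ_of_ne_zero h0
  refine ⟨i, by omega, ?_, by rwa [hi] at h1⟩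
  exact not_lt.1 (Nat.find_min hex (by omega))

/-- Away from the zeros, the sign of `g` is determined by the parity of the interval. -/
theorem neg_iff (h : AlternatesOn g a b N t s) {i : ℕ} (hi : i < N) {x : ℝ}
    (hx : x ∈ Set.Icc (t i) (t (i + 1))) (hgx : g x ≠ 0) : g x < 0 ↔ s * (-1) ^ i = -1 := by
  have h1 := h.nonneg i hi x hx
  have h2 : s * (-1) ^ i = 1 ∨ s * (-1) ^ i = -1 := by
    rcases h.sign with rfl | rfl <;> rcases neg_one_pow_eq_or ℝ i with hk | hk <;> simp [hk]
  rcases h2 with h2 | h2 <;> rw [h2] at h1 ⊢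
  · constructor
    · intro; linarith
    · intro; linarith
  · simp only [iff_true]
    exact lt_of_le_of_ne (by linarith) hgx

end AlternatesOn

/-! ### Convex duality: coercivity, minimizers and stationarity. -/

/-- A continuous positively homogeneous function that is positive away from `0` dominates a multiple
of the norm. -/
theorem exists_mul_norm_le {E : Type*} [NormedAddCommGroup E] [NormedSpace ℝ E] [ProperSpace E]
    {K : E → ℝ} (hK : Continuous K) (hsmul : ∀ c : ℝ, 0 ≤ c → ∀ v, K (c • v) = c * K v)
    (hpos : ∀ v, v ≠ 0 → 0 < K v) : ∃ c > 0, ∀ v, c * ‖v‖ ≤ K v := by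
  have hK0 : K 0 = 0 := by simpa using hsmul 0 le_rfl 0
  have hmem : ∀ v : E, v ≠ 0 → ‖v‖⁻¹ • v ∈ Metric.sphere (0 : E) 1 := fun v hv => by
    simp [norm_smul, hv]
  by_cases hne : (Metric.sphere (0 : E) 1).Nonempty
  · obtain ⟨u, hu, humin⟩ := (isCompact_sphere (0 : E) 1).exists_isMinOn hne hK.continuousOn
    have hu0 : u ≠ 0 := by
      rintro rfl
      simp at hu
    refine ⟨K u, hpos u hu0, fun v => ?_⟩
    by_cases hv : v = 0
    · simp [hv, hK0]
    · have h1 : K u ≤ K (‖v‖⁻¹ • v) := humin (hmem v hv)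
      have h2 : v = ‖v‖ • (‖v‖⁻¹ • v) := by
        rw [smul_smul, mul_inv_cancel₀ (norm_ne_zero_iff.2 hv), one_smul]
      calc K u * ‖v‖ ≤ ‖v‖ * K (‖v‖⁻¹ • v) := by
            rw [mul_comm]
            exact mul_le_mul_of_nonneg_left h1 (norm_nonneg v)
        _ = K v := by rw [← hsmul _ (norm_nonneg v), ← h2]
  · refine ⟨1, one_pos, fun v => ?_⟩
    have hv : v = 0 := by
      by_contra hv
      exact hne ⟨_, hmem v hv⟩
    simp [hv, hK0]

theorem integrable_bcf {μ : Measure ℝ} [IsFiniteMeasure μ] (v : ℝ →ᵇ ℝ) : Integrable v μ :=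
  v.integrable μ

theorem integrable_mul_bcf {μ : Measure ℝ} {F : ℝ → ℝ} (hF : Integrable F μ) (v : ℝ →ᵇ ℝ) :
    Integrable (fun t => F t * v t) μ :=
  hF.mul_bdd v.continuous.aestronglyMeasurable (c := ‖v‖)
    (Filter.Eventually.of_forall fun t => v.norm_coe_le_norm t)

/-- The convex functional dual to minimizing `∫ h φ` over the functions `h` with values in `[0, 1]`
with the same moments as `F`. -/
noncomputable def dualFunctional (μ : Measure ℝ) (F φ : ℝ → ℝ) (v : ℝ →ᵇ ℝ) : ℝ :=
  ∫ t, (F t * v t + max 0 (-(φ t + v t))) ∂μ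

/-- Taking `φ = 0` gives the recession function, whose positivity on nonzero vectors yields
coercivity. -/
theorem dualFunctional_zero_smul {μ : Measure ℝ} {F : ℝ → ℝ} {c : ℝ} (hc : 0 ≤ c) (v : ℝ →ᵇ ℝ) :
    dualFunctional μ F 0 (c • v) = c * dualFunctional μ F 0 v := by
  rw [dualFunctional, dualFunctional, ← integral_const_mul]
  congr 1
  ext t
  have : max 0 (-(c * v t)) = c * max 0 (-(v t)) := by
    rw [mul_max_of_nonneg _ _ hc]; simp
  simp only [Pi.zero_apply, zero_add, BoundedContinuousFunction.coe_smul, smul_eq_mul, this]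
  ring

section

variable {μ : Measure ℝ} [IsFiniteMeasure μ] {F φ : ℝ → ℝ}

theorem integrable_dual (hF : Integrable F μ) (hφ : Integrable φ μ) (v : ℝ →ᵇ ℝ) :
    Integrable (fun t => F t * v t + max 0 (-(φ t + v t))) μ := by
  refine (integrable_mul_bcf hF v).add ?_
  have h := ((hφ.add (integrable_bcf v)).neg).pos_part
  refine h.congr (Filter.Eventually.of_forall fun t => ?_)
  simp [max_comm]

theorem lipschitz_dualFunctional (hF : Integrable F μ) (hF01 : ∀ t, F t ∈ Set.Icc (0 : ℝ) 1)
    (hφ : Integrable φ μ) (v w : ℝ →ᵇ ℝ) :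
    |dualFunctional μ F φ v - dualFunctional μ F φ w| ≤ 2 * μ.real Set.univ * ‖v - w‖ := by
  rw [dualFunctional, dualFunctional,
    ← integral_sub (integrable_dual hF hφ v) (integrable_dual hF hφ w), ← Real.norm_eq_abs]
  refine (norm_integral_le_of_norm_le_const (C := 2 * ‖v - w‖)
    (Filter.Eventually.of_forall fun t => ?_)).trans_eq (by ring)
  have h1 : |v t - w t| ≤ ‖v - w‖ := by simpa using (v - w).norm_coe_le_norm t
  have h2 := hF01 t
  have h3 : |F t * (v t - w t)| ≤ |v t - w t| := by
    rw [abs_mul, abs_of_nonneg h2.1]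
    exact mul_le_of_le_one_left (abs_nonneg _) h2.2
  have h4 : |max 0 (-(φ t + v t)) - max 0 (-(φ t + w t))| ≤ |v t - w t| := by
    have := abs_max_sub_max_le_abs (-(φ t + v t)) (-(φ t + w t)) 0
    rw [max_comm, max_comm (-(φ t + w t))] at this
    refine this.trans_eq ?_
    rw [abs_sub_comm]
    congr 1
    ring
  rw [Real.norm_eq_abs]
  calc |F t * v t + max 0 (-(φ t + v t)) - (F t * w t + max 0 (-(φ t + w t)))|
      = |F t * (v t - w t) + (max 0 (-(φ t + v t)) - max 0 (-(φ t + w t)))| := by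
        congr 1; ring
    _ ≤ |F t * (v t - w t)| + |max 0 (-(φ t + v t)) - max 0 (-(φ t + w t))| := abs_add_le _ _
    _ ≤ 2 * ‖v - w‖ := by linarith

theorem continuous_dualFunctional (hF : Integrable F μ) (hF01 : ∀ t, F t ∈ Set.Icc (0 : ℝ) 1)
    (hφ : Integrable φ μ) : Continuous (dualFunctional μ F φ) := by
  refine (LipschitzWith.of_dist_le_mul (K := (2 * μ.real Set.univ).toNNReal)
    fun v w => ?_).continuous
  rw [Real.coe_toNNReal _ (by positivity), Real.dist_eq, dist_eq_norm]
  exact lipschitz_dualFunctional hF hF01 hφ v w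

/-- Since max(0, ·) is 1-Lipschitz, replacing `φ` by 0 costs at most ∫ |φ|; linear growth of the
recession function therefore passes to the functional itself. -/
theorem dualFunctional_ge (hF : Integrable F μ) (hφ : Integrable φ μ) (v : ℝ →ᵇ ℝ) :
    dualFunctional μ F 0 v - ∫ t, |φ t| ∂μ ≤ dualFunctional μ F φ v := by
  have h0 := integrable_dual hF (integrable_zero ℝ ℝ μ) v
  rw [dualFunctional, dualFunctional]
  rw [← integral_sub (by simpa using h0) hφ.abs]
  refine integral_mono ((by simpa using h0 : Integrable _ μ).sub hφ.abs)
    (integrable_dual hF hφ v) fun t => ?_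
  have h1 : max 0 (-v t) ≤ max 0 (-(φ t + v t)) + |φ t| := by
    have := le_abs_self (φ t)
    have := abs_nonneg (φ t)
    refine max_le ?_ ?_
    · have := le_max_left 0 (-(φ t + v t)); linarith
    · have := le_max_right 0 (-(φ t + v t)); linarith
  simp only [Pi.zero_apply, zero_add]
  linarith

/-- The dual functional attains its minimum on a finite-dimensional subspace on which its recession
function is positive. -/
theorem exists_dual_min (hF : Integrable F μ) (hF01 : ∀ t, F t ∈ Set.Icc (0 : ℝ) 1)
    (hφ : Integrable φ μ) (V : Submodule ℝ (ℝ →ᵇ ℝ)) [FiniteDimensional ℝ V]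
    (hpos : ∀ v ∈ V, v ≠ 0 → 0 < dualFunctional μ F 0 v) :
    ∃ q ∈ V, ∀ v ∈ V, dualFunctional μ F φ q ≤ dualFunctional μ F φ v := by
  have : ProperSpace V := FiniteDimensional.proper_real V
  have hK : Continuous fun v : V => dualFunctional μ F 0 (v : ℝ →ᵇ ℝ) :=
    (continuous_dualFunctional hF hF01 (integrable_zero ℝ ℝ μ)).comp continuous_subtype_val
  have hJ : Continuous fun v : V => dualFunctional μ F φ (v : ℝ →ᵇ ℝ) :=
    (continuous_dualFunctional hF hF01 hφ).comp continuous_subtype_val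
  obtain ⟨c, hc, hcK⟩ : ∃ c > 0, ∀ v : V, c * ‖v‖ ≤ dualFunctional μ F 0 (v : ℝ →ᵇ ℝ) := by
    refine exists_mul_norm_le hK (fun c hc v => dualFunctional_zero_smul hc (v : ℝ →ᵇ ℝ))
      fun v hv => hpos v v.2 fun h => hv (Subtype.ext h)
  have hlim : Filter.Tendsto (fun v : V => dualFunctional μ F φ (v : ℝ →ᵇ ℝ))
      (Filter.cocompact V) Filter.atTop := by
    refine Filter.tendsto_atTop_mono (f := fun v : V => c * ‖v‖ - ∫ t, |φ t| ∂μ)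
      (fun v => ?_) ?_
    · exact (sub_le_sub_right (hcK v) _).trans (dualFunctional_ge hF hφ v)
    · exact Filter.tendsto_atTop_add_const_right _ _
        ((tendsto_norm_cocompact_atTop (E := V)).const_mul_atTop hc)
  obtain ⟨q, hq⟩ := hJ.exists_forall_le hlim
  exact ⟨q, q.2, fun v hv => hq ⟨v, hv⟩⟩

/-- The stationarity condition at a minimum of the dual functional. -/
theorem integral_le_of_dual_min (hF : Integrable F μ) (hφ : Integrable φ μ) {q r : ℝ →ᵇ ℝ}
    (hmin : ∀ ε > (0 : ℝ), dualFunctional μ F φ q ≤ dualFunctional μ F φ (q + ε • r))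
    (hne : ∀ᵐ t ∂μ, φ t + q t ≠ 0) :
    ∫ t, {t | φ t + q t < 0}.indicator r t ∂μ ≤ ∫ t, F t * r t ∂μ := by
  let ε : ℕ → ℝ := fun k => 1 / ((k : ℝ) + 1)
  have hε : ∀ k, 0 < ε k := fun k => Nat.one_div_pos_of_nat
  have hε0 : Filter.Tendsto ε Filter.atTop (nhds 0) := tendsto_one_div_add_atTop_nhds_zero_nat
  have hφq : ∀ v : ℝ →ᵇ ℝ, AEStronglyMeasurable (fun t => φ t + v t) μ := fun v =>
    hφ.aestronglyMeasurable.add v.continuous.aestronglyMeasurable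
  have hmeas : ∀ v : ℝ →ᵇ ℝ,
      AEStronglyMeasurable ({t | φ t + v t < 0}.indicator (r : ℝ → ℝ)) μ := fun v =>
    r.continuous.aestronglyMeasurable.indicator₀
      (nullMeasurableSet_lt (hφq v).aemeasurable aemeasurable_const)
  have hbd : ∀ (v : ℝ →ᵇ ℝ) t, ‖{t | φ t + v t < 0}.indicator (r : ℝ → ℝ) t‖ ≤ ‖r‖ :=
    fun v t => (norm_indicator_le_norm_self _ _).trans (r.norm_coe_le_norm t)
  have hint : ∀ v : ℝ →ᵇ ℝ, Integrable ({t | φ t + v t < 0}.indicator (r : ℝ → ℝ)) μ :=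
    fun v => Integrable.of_bound (hmeas v) ‖r‖ (Filter.Eventually.of_forall (hbd v))
  -- Off the null set where φ + q = 0 the strict sign is stable under small perturbations, so the
  -- indicators converge pointwise.
  have hlim : Filter.Tendsto
      (fun k => ∫ t, {t | φ t + (q + ε k • r) t < 0}.indicator (r : ℝ → ℝ) t ∂μ) Filter.atTop
      (nhds (∫ t, {t | φ t + q t < 0}.indicator (r : ℝ → ℝ) t ∂μ)) := by
    refine tendsto_integral_of_dominated_convergence (fun _ => ‖r‖) (fun k => hmeas _)
      (integrable_const _) (fun k => Filter.Eventually.of_forall (hbd _)) ?_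
    filter_upwards [hne] with t ht
    have hc : Filter.Tendsto (fun k => φ t + (q + ε k • r) t) Filter.atTop
        (nhds (φ t + q t)) := by
      have := (hε0.mul_const (r t)).const_add (φ t + q t)
      simpa [add_assoc] using this
    refine tendsto_const_nhds.congr' ?_
    rcases lt_or_gt_of_ne ht with h | h
    · filter_upwards [hc.eventually_lt_const h] with k hk
      rw [Set.indicator_of_mem (by exact h), Set.indicator_of_mem (by exact hk)]
    · filter_upwards [hc.eventually_const_lt h] with k hk
      rw [Set.indicator_of_notMem (by simpa using h.le),
        Set.indicator_of_notMem (by simpa using hk.le)]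
  refine le_of_tendsto' hlim fun k => ?_
  have h1 := hmin (ε k) (hε k)
  -- Convexity, with the subgradient taken at the perturbed point `q + ε k • r` rather than at `q`:
  -- minimality then bounds the perturbed integral for every `k`, before passing to the limit.
  have h2 : dualFunctional μ F φ (q + ε k • r) ≤ dualFunctional μ F φ q +
      ε k * (∫ t, F t * r t ∂μ -
        ∫ t, {t | φ t + (q + ε k • r) t < 0}.indicator (r : ℝ → ℝ) t ∂μ) := by
    have hi1 := integrable_dual hF hφ q
    have hi2 := integrable_mul_bcf hF r
    have hi3 := hint (q + ε k • r)
    have hi4 : Integrable (fun t => ε k * (F t * r t -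
        {t | φ t + (q + ε k • r) t < 0}.indicator (r : ℝ → ℝ) t)) μ := (hi2.sub hi3).const_mul _
    rw [dualFunctional, dualFunctional, ← integral_sub hi2 hi3, ← integral_const_mul,
      ← integral_add hi1 hi4]
    refine integral_mono (integrable_dual hF hφ _) (hi1.add hi4)
      fun t => ?_
    simp only [BoundedContinuousFunction.coe_add, BoundedContinuousFunction.coe_smul, Pi.add_apply,
      smul_eq_mul, Set.indicator_apply, Set.mem_ofPred_eq]
    have h3 := le_max_left 0 (-(φ t + q t))
    have h4 := le_max_right 0 (-(φ t + q t))
    split_ifs with hlt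
    · rw [max_eq_right (a := 0) (b := -(φ t + (q t + ε k * r t))) (by linarith)]
      linarith
    · rw [max_eq_left (a := 0) (b := -(φ t + (q t + ε k * r t))) (by linarith)]
      linarith
  have h3 : 0 ≤ ε k * (∫ t, F t * r t ∂μ -
        ∫ t, {t | φ t + (q + ε k • r) t < 0}.indicator (r : ℝ → ℝ) t ∂μ) := by linarith
  linarith [nonneg_of_mul_nonneg_right h3 (hε k)]

/-- If `F` has values in `[0, 1]` and its recession function is positive on `V`, it has the same moments
as the characteristic function of a sublevel set. -/
theorem exists_moments_eq (hF : Integrable F μ) (hF01 : ∀ t, F t ∈ Set.Icc (0 : ℝ) 1)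
    (hφ : Integrable φ μ) (V : Submodule ℝ (ℝ →ᵇ ℝ)) [FiniteDimensional ℝ V]
    (hpos : ∀ v ∈ V, v ≠ 0 → 0 < dualFunctional μ F 0 v)
    (hne : ∀ q ∈ V, ∀ᵐ t ∂μ, φ t + q t ≠ 0) :
    ∃ q ∈ V, ∀ r ∈ V, ∫ t, F t * r t ∂μ = ∫ t, {t | φ t + q t < 0}.indicator r t ∂μ := by
  obtain ⟨q, hq, hmin⟩ := exists_dual_min hF hF01 hφ V hpos
  refine ⟨q, hq, fun r hr => ?_⟩
  have h1 : ∀ r ∈ V, ∫ t, {t | φ t + q t < 0}.indicator r t ∂μ ≤ ∫ t, F t * r t ∂μ :=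
    fun r hr => integral_le_of_dual_min hF hφ
      (fun ε _ => hmin _ (V.add_mem hq (V.smul_mem ε hr))) (hne q hq)
  refine le_antisymm ?_ (h1 r hr)
  -- Applying the one-sided inequality to `-r` turns it into an equality.
  have h2 := h1 (-r) (V.neg_mem hr)
  have h3 : ({t | φ t + q t < 0}.indicator ((-r : ℝ →ᵇ ℝ) : ℝ → ℝ)) =
      fun t => -{t | φ t + q t < 0}.indicator (r : ℝ → ℝ) t :=
    Set.indicator_neg _ _
  rw [h3] at h2
  simp only [BoundedContinuousFunction.coe_neg, Pi.neg_apply, mul_neg, integral_neg] at h2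
  linarith

end

/-! ### Zero counts over one period. -/

/-- Lebesgue measure on a period. -/
noncomputable abbrev periodMeasure : Measure ℝ := volume.restrict (Set.Ico 0 (2 * Real.pi))

theorem Set.finite_of_forall_finset_card_le {α : Type*} {Z : Set α} {k : ℕ}
    (h : ∀ S : Finset α, (∀ x ∈ S, x ∈ Z) → S.card ≤ k) : Z.Finite := by
  by_contra hZ
  obtain ⟨S, hS, hk⟩ := Set.Infinite.exists_subset_card_eq hZ (k + 1)
  have := h S fun x hx => hS hx
  omega

theorem ae_periodMeasure_of_finite {p : ℝ → Prop}
    (h : {x ∈ Set.Ico 0 (2 * Real.pi) | ¬ p x}.Finite) : ∀ᵐ x ∂periodMeasure, p x := by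
  rw [ae_restrict_iff' measurableSet_Ico, ae_iff]
  convert h.measure_zero volume using 2
  ext x
  simp [and_assoc]

theorem ae_periodMeasure_mem_Ioo : ∀ᵐ x ∂periodMeasure, x ∈ Set.Ioo 0 (2 * Real.pi) :=
  ae_periodMeasure_of_finite <| (Set.finite_singleton (0 : ℝ)).subset fun x hx => by
    by_contra h
    exact hx.2 ⟨lt_of_le_of_ne hx.1.1 fun h0 => h h0.symm, hx.1.2⟩

theorem trigPoly_zeros_finite {m : ℕ} {v : ℝ →ᵇ ℝ} (hv : v ∈ trigPoly m) (h0 : v ≠ 0) :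
    {x ∈ Set.Ico 0 (2 * Real.pi) | v x = 0}.Finite :=
  Set.finite_of_forall_finset_card_le (trigPoly_card_zeros_le hv h0)

/-- The sum of the identity and a trigonometric polynomial of degree `m` has at most `2 * m + 1`
zeros in a closed period. -/
theorem id_add_trigPoly_card_zeros_le {m : ℕ} {q : ℝ →ᵇ ℝ} (hq : q ∈ trigPoly m)
    (S : Finset ℝ) (hS : ∀ x ∈ S, x ∈ Set.Icc 0 (2 * Real.pi) ∧ x + q x = 0) :
    S.card ≤ 2 * m + 1 := by
  obtain ⟨w, p, hp, hw, hpe⟩ := trigPoly_hasDerivAt hq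
  have hP : ∀ t, HasDerivAt (fun t => t + q t) (1 + w t) t := fun t => (hasDerivAt_id t).add (hw t)
  by_contra! hcard
  obtain ⟨k, hk⟩ : ∃ k, S.card = k + 1 := ⟨S.card - 1, by omega⟩
  have hmono := (S.orderEmbOfFin hk).strictMono
  have hmem := S.orderEmbOfFin_mem hk
  -- Rolle: k + 1 zeros of t + q(t) enclose k zeros of 1 + q', a trigonometric polynomial of degree
  -- at most `m`.
  have hroot : ∀ i : Fin k, ∃ c ∈ Set.Ioo (S.orderEmbOfFin hk i.castSucc)
      (S.orderEmbOfFin hk i.succ), 1 + w c = 0 := fun i =>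
    exists_hasDerivAt_eq_zero (hmono (Fin.castSucc_lt_succ))
      (fun x _ => (hP x).continuousAt.continuousWithinAt)
      ((hS _ (hmem _)).2.trans (hS _ (hmem _)).2.symm) fun x _ => hP x
  choose c hc hc0 using hroot
  have hcmono : StrictMono c := by
    intro i j hij
    exact (hc i).2.trans_le ((hmono.monotone (Fin.succ_le_castSucc_iff.2 hij)).trans (hc j).1.le)
  have hle := card_zeros_le (g := fun t => 1 + w t) (p := X ^ m + p) (m := m)
    ((natDegree_add_le _ _).trans (max_le (by rw [natDegree_X_pow]; omega) hp))
    (fun t => by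
      rw [eval_add, ← hpe, eval_pow, eval_X]
      push_cast
      ring)
    (by
      by_contra! h
      -- If 1 + q' vanished identically, t + q(t) would be constant, yet it grows by 2π over a
      -- period.
      have hconst := is_const_of_deriv_eq_zero (f := fun t => t + q t)
        (fun t => (hP t).differentiableAt) (fun t => by rw [(hP t).deriv, h t])
        (0 + 2 * Real.pi) 0
      simp only [trigPoly_add_two_pi hq] at hconst
      linarith [Real.pi_pos])
    (Finset.univ.image c) (fun x hx => by
      obtain ⟨i, -, rfl⟩ := Finset.mem_image.1 hx
      exact ⟨⟨(hS _ (hmem _)).1.1.trans (hc i).1.le, (hc i).2.trans_le (hS _ (hmem _)).1.2⟩,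
        hc0 i⟩)
  rw [Finset.card_image_of_injective _ hcmono.injective, Finset.card_univ, Fintype.card_fin] at hle
  omega

theorem id_add_trigPoly_zeros_finite {m : ℕ} {q : ℝ →ᵇ ℝ} (hq : q ∈ trigPoly m) :
    {x ∈ Set.Icc 0 (2 * Real.pi) | x + q x = 0}.Finite :=
  Set.finite_of_forall_finset_card_le (id_add_trigPoly_card_zeros_le hq)

/-! ### Negativity sets as unions of arcs. -/

theorem mem_arcUnion {n : ℕ} {a b : Fin n → ℝ} {x : ℝ} :
    Circle.exp x ∈ arcUnion a b ↔ ∃ r, ∃ k : ℤ, x + k * (2 * Real.pi) ∈ Set.Icc (a r) (b r) := by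
  simp only [arcUnion, Set.mem_iUnion, Set.mem_image, Circle.exp_eq_exp]
  refine exists_congr fun r => ⟨?_, ?_⟩
  · rintro ⟨u, hu, k, rfl⟩
    exact ⟨k, hu⟩
  · rintro ⟨k, hk⟩
    exact ⟨_, hk, k, rfl⟩

theorem int_eq_zero_of_add_mem {x : ℝ} {k : ℤ} (hx : x ∈ Set.Ioo 0 (2 * Real.pi))
    (hk : x + k * (2 * Real.pi) ∈ Set.Icc 0 (2 * Real.pi)) : k = 0 := by
  have hpi := Real.pi_pos
  have h1 : (k : ℝ) < 1 := by
    by_contra! hc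
    nlinarith [hx.1, hk.2]
  have h2 : (-1 : ℝ) < k := by
    by_contra! hc
    nlinarith [hx.2, hk.1]
  have h3 : k < 1 := by exact_mod_cast h1
  have h4 : -1 < k := by exact_mod_cast h2
  omega

theorem neg_one_pow_eq_iff {i j : ℕ} : (-1 : ℝ) ^ i = (-1) ^ j ↔ i % 2 = j % 2 := by
  rw [neg_one_pow_eq_pow_mod_two, neg_one_pow_eq_pow_mod_two (n := j)]
  rcases Nat.mod_two_eq_zero_or_one i with hi | hi <;>
    rcases Nat.mod_two_eq_zero_or_one j with hj | hj <;> norm_num [hi, hj]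

section

variable {g : ℝ → ℝ} {N : ℕ} {t : ℕ → ℝ} {s : ℝ}

theorem AlternatesOn.Icc_subset {a b : ℝ} (h : AlternatesOn g a b N t s) {i : ℕ} (hi : i < N) :
    Set.Icc (t i) (t (i + 1)) ⊆ Set.Icc a b := by
  rw [← h.left, ← h.right]
  exact Set.Icc_subset_Icc (h.strictMono.monotone (by omega)) (h.strictMono.monotone (by omega))

/-- The negativity set as the union of the intervals of one parity. -/
theorem AlternatesOn.mem_arcUnion_iff (h : AlternatesOn g 0 (2 * Real.pi) N t s) {e M : ℕ}
    (he : e ≤ 1) (hs : s * (-1) ^ e = -1) (h1 : 2 * M + e ≤ N + 1) (h2 : N ≤ 2 * M + e) {x : ℝ}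
    (hx : x ∈ Set.Ioo 0 (2 * Real.pi)) (hgx : g x ≠ 0) :
    Circle.exp x ∈ arcUnion (fun r : Fin M => t (2 * r + e)) (fun r => t (2 * r + e + 1)) ↔
      g x < 0 := by
  -- Here `e` is the parity of the negative intervals, and the two bounds say that `M` is exactly
  -- the number of indices below `N` of that parity.
  rw [mem_arcUnion]
  constructor
  · rintro ⟨r, k, hk⟩
    have hr : 2 * (r : ℕ) + e < N := by omega
    obtain rfl := int_eq_zero_of_add_mem hx (h.Icc_subset hr hk)
    rw [h.neg_iff hr (by simpa using hk) hgx, pow_add, pow_mul]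
    simpa using hs
  · intro hneg
    obtain ⟨i, hi, hxi⟩ := h.exists_mem (Set.Ioo_subset_Ico_self hx)
    have hsi := (h.neg_iff hi (Set.Ico_subset_Icc_self hxi) hgx).1 hneg
    have hs0 : s ≠ 0 := by rcases h.sign with rfl | rfl <;> norm_num
    have hp := neg_one_pow_eq_iff.1 (mul_left_cancel₀ hs0 (hsi.trans hs.symm))
    have hie : 2 * ((i - e) / 2) + e = i := by omega
    refine ⟨⟨(i - e) / 2, by omega⟩, 0, ?_⟩
    simpa [hie] using Set.Ico_subset_Icc_self hxi

/-- The negativity set when the first and last intervals merge into one arc. -/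
theorem AlternatesOn.mem_arcUnion_iff_wrap {M : ℕ}
    (h : AlternatesOn g 0 (2 * Real.pi) (2 * M + 1) t (-1)) (hM : 0 < M) {x : ℝ}
    (hx : x ∈ Set.Ioo 0 (2 * Real.pi)) (hgx : g x ≠ 0) :
    Circle.exp x ∈ arcUnion (fun r : Fin M => t (2 * r + 2))
      (fun r => if (r : ℕ) + 1 = M then t 1 + 2 * Real.pi else t (2 * r + 3)) ↔ g x < 0 := by
  have hpi := Real.pi_pos
  have ht1 : t 1 < 2 * Real.pi := h.right ▸ h.strictMono (by omega)
  have ht1' : 0 < t 1 := h.left ▸ h.strictMono one_pos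
  rw [mem_arcUnion]
  constructor
  · rintro ⟨r, k, hk⟩
    have hr := r.2
    by_cases hrM : (r : ℕ) + 1 = M
    · simp only [hrM, if_true] at hk
      have htr : 0 < t (2 * r + 2) := h.left ▸ h.strictMono (by omega)
      have h1 : (k : ℝ) < 2 := by
        by_contra! hc
        nlinarith [hx.1, hk.2]
      have h2 : (-1 : ℝ) < k := by
        by_contra! hc
        nlinarith [hx.2, hk.1]
      have h3 : k < 2 := by exact_mod_cast h1
      have h4 : -1 < k := by exact_mod_cast h2
      -- The merged arc crosses 2π: `k = 0` is the last interval, `k = 1` the first one shifted by a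
      -- period.
      obtain rfl | rfl : k = 0 ∨ k = 1 := by omega
      · have hlast : t (2 * r + 2 + 1) = 2 * Real.pi := by rw [← h.right]; congr 1; omega
        rw [h.neg_iff (i := 2 * r + 2) (by omega) ⟨by simpa using hk.1, hlast ▸ hx.2.le⟩ hgx]
        simp [pow_add, pow_mul]
      · have hx1 : x ≤ t 1 := by
          have := hk.2
          push_cast at this
          linarith
        rw [h.neg_iff (i := 0) (by omega) ⟨h.left ▸ hx.1.le, hx1⟩ hgx]
        simp
    · simp only [hrM, if_false] at hk
      have hr2 : 2 * (r : ℕ) + 2 < 2 * M + 1 := by omega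
      obtain rfl := int_eq_zero_of_add_mem hx (h.Icc_subset hr2 hk)
      rw [h.neg_iff hr2 (by simpa using hk) hgx]
      simp [pow_add, pow_mul]
  · intro hneg
    obtain ⟨i, hi, hxi⟩ := h.exists_mem (Set.Ioo_subset_Ico_self hx)
    have hsi := (h.neg_iff hi (Set.Ico_subset_Icc_self hxi) hgx).1 hneg
    have hp : i % 2 = 0 % 2 := neg_one_pow_eq_iff.1 (by linarith)
    rcases Nat.eq_zero_or_pos i with rfl | hi0
    · refine ⟨⟨M - 1, by omega⟩, 1, ?_⟩
      have hle : t (2 * (M - 1) + 2) ≤ 2 * Real.pi :=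
        h.right ▸ h.strictMono.monotone (by omega)
      simp only [Nat.sub_add_cancel hM, if_true]
      have := hxi.2
      rw [zero_add] at this
      push_cast
      exact ⟨by linarith [hx.1], by linarith⟩
    · obtain ⟨r, rfl⟩ : ∃ r, i = 2 * r + 2 := ⟨i / 2 - 1, by omega⟩
      refine ⟨⟨r, by omega⟩, 0, ?_⟩
      by_cases hrM : r + 1 = M
      · simp only [hrM, if_true]
        exact ⟨by simpa using hxi.1, by push_cast; linarith [hx.2]⟩
      · simp only [hrM, if_false]
        simpa using Set.Ico_subset_Icc_self hxi

/-- At most half of the intervals count as arcs: when `N` is odd and both outer intervals are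
negative, they merge across the base point, or form the whole circle if `N = 1`. -/
theorem AlternatesOn.circleAEEq (h : AlternatesOn g 0 (2 * Real.pi) N t s) {f : Circle → ℝ}
    (hg : ∀ᵐ x ∂periodMeasure, g x ≠ 0)
    (hf : ∀ᵐ x ∂periodMeasure, f (Circle.exp x) = {x | g x < 0}.indicator 1 x) :
    CircleAEEq f 1 ∨ ∃ a b : Fin (N / 2) → ℝ, CircleAEEq f ((arcUnion a b).indicator 1) := by
  have key : ∀ A : Set Circle, (∀ x ∈ Set.Ioo 0 (2 * Real.pi), g x ≠ 0 →
      (Circle.exp x ∈ A ↔ g x < 0)) → CircleAEEq f (A.indicator 1) := by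
    intro A hA
    filter_upwards [hg, hf, ae_periodMeasure_mem_Ioo] with x hgx hfx hx
    rw [hfx]
    by_cases hneg : g x < 0
    · rw [Set.indicator_of_mem ((hA x hx hgx).2 hneg), Set.indicator_of_mem (by exact hneg)]
      rfl
    · rw [Set.indicator_of_notMem (fun hc => hneg ((hA x hx hgx).1 hc)),
        Set.indicator_of_notMem (by exact hneg)]
  rcases h.sign with rfl | rfl
  · exact Or.inr ⟨_, _, key _ fun x hx hgx =>
      h.mem_arcUnion_iff (e := 1) le_rfl (by norm_num) (by omega) (by omega) hx hgx⟩
  · rcases Nat.even_or_odd' N with ⟨M, rfl | rfl⟩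
    · exact Or.inr ⟨_, _, key _ fun x hx hgx =>
        h.mem_arcUnion_iff (e := 0) zero_le_one (by norm_num) (by omega) (by omega) hx hgx⟩
    · rw [show (2 * M + 1) / 2 = M by omega]
      rcases Nat.eq_zero_or_pos M with rfl | hM
      · left
        have := key Set.univ fun x hx hgx => by
          have h2 := h.right
          rw [h.neg_iff (i := 0) one_pos ⟨h.left ▸ hx.1.le, ?_⟩ hgx]
          · simp
          · exact (hx.2.trans_eq h2.symm).le
        rwa [Set.indicator_univ] at this
      · exact Or.inr ⟨_, _, key _ fun x hx hgx => h.mem_arcUnion_iff_wrap hM hx hgx⟩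

end

/-! ### The degenerate case, and polynomials with prescribed signs. -/

/-- If the recession function is not positive, `f` is the characteristic function of few arcs. -/
theorem isArcUnionOfFewerThan_of_dualFunctional_le {m : ℕ} {f : Circle → ℝ}
    (hF : Integrable (fun t => f (Circle.exp t)) periodMeasure)
    (hf : ∀ z, f z ∈ Set.Icc (0 : ℝ) 1) {v : ℝ →ᵇ ℝ} (hv : v ∈ trigPoly m) (h0 : v ≠ 0)
    (hK : dualFunctional periodMeasure (fun t => f (Circle.exp t)) 0 v ≤ 0) :
    IsArcUnionOfFewerThan (m + 1) f := by
  have hfin := trigPoly_zeros_finite hv h0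
  have hne : ∀ᵐ t ∂periodMeasure, v t ≠ 0 := ae_periodMeasure_of_finite (by simpa using hfin)
  have hint := integrable_dual hF (integrable_zero ℝ ℝ periodMeasure) v
  -- The integrand is F v⁺ + (1 - F) v⁻; once it vanishes almost everywhere, F is 1 where v < 0 and
  -- 0 where v > 0.
  have hnonneg : 0 ≤ fun t => f (Circle.exp t) * v t + max 0 (-((0 : ℝ → ℝ) t + v t)) := by
    intro t
    have h1 := hf (Circle.exp t)
    simp only [Pi.zero_apply, zero_add]
    rcases le_total 0 (v t) with h | h
    · have := mul_nonneg h1.1 h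
      have := le_max_left 0 (-v t)
      linarith
    · rw [max_eq_right (by linarith)]
      nlinarith [h1.2]
  have hzero := (integral_eq_zero_iff_of_nonneg hnonneg hint).1
    (le_antisymm hK (integral_nonneg hnonneg))
  have hfe : ∀ᵐ x ∂periodMeasure, f (Circle.exp x) = {x | v x < 0}.indicator 1 x := by
    filter_upwards [hne, hzero] with x hx hx0
    simp only [Pi.zero_apply, zero_add] at hx0
    rcases lt_or_gt_of_ne hx with h | h
    · rw [max_eq_right (by linarith)] at hx0
      rw [Set.indicator_of_mem (by exact h)]
      exact mul_right_cancel₀ hx (by simp only [Pi.one_apply]; linarith)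
    · rw [max_eq_left (by linarith), add_zero] at hx0
      rw [Set.indicator_of_notMem (by simpa using h.le)]
      exact (mul_eq_zero.1 hx0).resolve_right hx
  obtain ⟨N, t, s, h⟩ := exists_alternatesOn v.continuous Real.two_pi_pos
    (hfin.subset fun x hx => ⟨Set.Ioo_subset_Ico_self hx.1, hx.2⟩)
  have hN : N ≤ 2 * m + 1 := h.pred_le fun S hS => trigPoly_card_zeros_le hv h0 S fun x hx =>
    ⟨Set.Ioo_subset_Ico_self (hS x hx).1, (hS x hx).2⟩
  rcases h.circleAEEq hne hfe with h1 | ⟨a, b, hab⟩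
  · exact Or.inl h1
  · exact Or.inr ⟨N / 2, by omega, a, b, hab⟩

/-- A trigonometric polynomial with prescribed sign changes. -/
theorem AlternatesOn.exists_trigPoly {g : ℝ → ℝ} {N m : ℕ} {t : ℕ → ℝ} {s : ℝ}
    (h : AlternatesOn g 0 (2 * Real.pi) N t s) (hN : N ≤ 2 * m + 1) :
    ∃ r ∈ trigPoly m, r ≠ 0 ∧ ∀ x ∈ Set.Ioo 0 (2 * Real.pi), 0 ≤ r x * g x := by
  have hmono := h.strictMono.monotone
  have hNpos := h.pos
  -- The number of sine factors must be even. For even `N` the harmless zero at `t 0 = 0`, an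
  -- endpoint of the period, is added to the interior points.
  obtain ⟨e, l, he, hel, hl⟩ : ∃ e l, e ≤ 1 ∧ N - e = 2 * l ∧ l ≤ m := by
    rcases Nat.even_or_odd' N with ⟨M, hM | hM⟩
    · exact ⟨0, M, zero_le_one, by omega, by omega⟩
    · exact ⟨1, M, le_rfl, by omega, by omega⟩
  obtain ⟨v, hv, hve⟩ := prod_sin_mem_trigPoly hl (Finset.Ico e N)
    ((Nat.card_Ico e N).trans hel) t
  have htj : ∀ j ∈ Finset.Ico e N, 0 ≤ t j ∧ t j ≤ 2 * Real.pi := fun j hj =>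
    ⟨h.left ▸ hmono j.zero_le, h.right ▸ hmono (Finset.mem_Ico.1 hj).2.le⟩
  -- On interval `i` the N - 1 - i factors with index above `i` are nonpositive and the others
  -- nonnegative, whence the normalizing sign.
  refine ⟨(s * (-1) ^ (N - 1)) • v, (trigPoly m).smul_mem _ hv, ?_, fun x hx => ?_⟩
  · refine smul_ne_zero (mul_ne_zero ?_ (by simp)) fun hv0 => ?_
    · rcases h.sign with rfl | rfl <;> norm_num
    · have h01 := h.strictMono one_pos
      have h12 : t 1 ≤ 2 * Real.pi := h.right ▸ hmono hNpos
      have h0 := h.left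
      have hz := hve ((t 0 + t 1) / 2)
      rw [hv0, BoundedContinuousFunction.coe_zero, Pi.zero_apply, eq_comm,
        Finset.prod_eq_zero_iff] at hz
      obtain ⟨j, hj, hj0⟩ := hz
      have hjb := htj j hj
      rw [Real.sin_eq_zero_iff_of_lt_of_lt (by linarith) (by linarith)] at hj0
      rcases Nat.eq_zero_or_pos j with rfl | hj1
      · linarith
      · have := hmono (show 1 ≤ j from hj1)
        linarith
  · obtain ⟨i, hi, hxi⟩ := h.exists_mem (Set.Ioo_subset_Ico_self hx)
    have hg := h.nonneg i hi x (Set.Ico_subset_Icc_self hxi)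
    have hsplit := Finset.prod_Ico_consecutive (fun j => Real.sin ((x - t j) / 2))
      (show e ≤ i + 1 by omega) (show i + 1 ≤ N from hi)
    have hleft : 0 ≤ ∏ j ∈ Finset.Ico e (i + 1), Real.sin ((x - t j) / 2) := by
      refine Finset.prod_nonneg fun j hj => ?_
      rw [Finset.mem_Ico] at hj
      have h1 := htj j (Finset.mem_Ico.2 ⟨hj.1, by omega⟩)
      have h2 := hmono (show j ≤ i by omega)
      exact Real.sin_nonneg_of_nonneg_of_le_pi (by linarith [hxi.1]) (by linarith [hx.2])
    have hright : 0 ≤ (-1) ^ (N - (i + 1)) *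
        ∏ j ∈ Finset.Ico (i + 1) N, Real.sin ((x - t j) / 2) := by
      rw [← Nat.card_Ico (i + 1) N, ← Finset.prod_const, ← Finset.prod_mul_distrib]
      refine Finset.prod_nonneg fun j hj => ?_
      rw [Finset.mem_Ico] at hj
      have h1 := htj j (Finset.mem_Ico.2 ⟨by omega, hj.2⟩)
      have h2 := hmono hj.1
      rw [neg_one_mul, ← Real.sin_neg]
      exact Real.sin_nonneg_of_nonneg_of_le_pi (by linarith [hxi.2]) (by linarith [hx.1])
    have hpow : (-1 : ℝ) ^ (N - 1) = (-1) ^ i * (-1) ^ (N - (i + 1)) := by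
      rw [← pow_add]
      congr 1
      omega
    simp only [BoundedContinuousFunction.coe_smul, smul_eq_mul]
    rw [hve, ← hsplit, hpow]
    calc (0 : ℝ) ≤ (s * (-1) ^ i * g x) *
          ((∏ j ∈ Finset.Ico e (i + 1), Real.sin ((x - t j) / 2)) *
          ((-1) ^ (N - (i + 1)) * ∏ j ∈ Finset.Ico (i + 1) N, Real.sin ((x - t j) / 2))) :=
        mul_nonneg hg (mul_nonneg hleft hright)
      _ = _ := by ring

/-! ### Fourier coefficients and the construction of the crisp subset. -/

theorem circleCoeff_eq_of_moments {f g : Circle → ℝ} {k : ℕ}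
    (hf : Integrable (fun t => f (Circle.exp t)) periodMeasure)
    (hg : Integrable (fun t => g (Circle.exp t)) periodMeasure)
    (hcos : ∫ t, f (Circle.exp t) * Real.cos (k * t) ∂periodMeasure =
      ∫ t, g (Circle.exp t) * Real.cos (k * t) ∂periodMeasure)
    (hsin : ∫ t, f (Circle.exp t) * Real.sin (k * t) ∂periodMeasure =
      ∫ t, g (Circle.exp t) * Real.sin (k * t) ∂periodMeasure) :
    circleCoeff f k = circleCoeff g k := by
  have key : ∀ h : Circle → ℝ, Integrable (fun t => h (Circle.exp t)) periodMeasure →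
      ∫ t in (0 : ℝ)..(2 * Real.pi), (h (Circle.exp t) : ℂ) *
          Complex.exp (Complex.I * ((k : ℤ) : ℂ) * t) =
        ((∫ t, h (Circle.exp t) * Real.cos (k * t) ∂periodMeasure : ℝ) : ℂ) +
          ((∫ t, h (Circle.exp t) * Real.sin (k * t) ∂periodMeasure : ℝ) : ℂ) * Complex.I := by
    intro h hh
    obtain ⟨c, -, hc⟩ := cos_mem_trigPoly (le_refl k)
    obtain ⟨d, -, hd⟩ := sin_mem_trigPoly (le_refl k)
    have hic := integrable_mul_bcf hh c
    have his := integrable_mul_bcf hh d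
    simp only [hc] at hic
    simp only [hd] at his
    rw [intervalIntegral.integral_of_le Real.two_pi_pos.le, ← integral_Ico_eq_integral_Ioc,
      ← integral_complex_ofReal, ← integral_complex_ofReal, ← integral_mul_const,
      ← integral_add hic.ofReal (his.ofReal.mul_const _)]
    refine integral_congr_ae (Filter.Eventually.of_forall fun t => ?_)
    have : Complex.I * ((k : ℤ) : ℂ) * t = (k * t : ℂ) * Complex.I := by
      push_cast
      ring
    simp only [this, Complex.exp_mul_I]
    push_cast
    ring
  rw [circleCoeff, circleCoeff, key f hf, key g hg, hcos, hsin]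

theorem exists_crisp {f : Circle → ℝ} (hf : f ∈ FuzzySubsets) (m : ℕ)
    (hn : ¬ IsArcUnionOfFewerThan (m + 1) f) :
    ∃ χ ∈ CrispSubsets (m + 1), ∀ k : ℕ, k < m + 1 → circleCoeff χ k = circleCoeff f k := by
  obtain ⟨hf01, hF⟩ := hf
  change Integrable _ periodMeasure at hF
  have hpos : ∀ v ∈ trigPoly m, v ≠ 0 →
      0 < dualFunctional periodMeasure (fun t => f (Circle.exp t)) 0 v := fun v hv h0 => by
    by_contra! hK
    exact hn (isArcUnionOfFewerThan_of_dualFunctional_le hF hf01 hv h0 hK)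
  have hne : ∀ q ∈ trigPoly m, ∀ᵐ t ∂periodMeasure, t + q t ≠ 0 := fun q hq =>
    ae_periodMeasure_of_finite <| (id_add_trigPoly_zeros_finite hq).subset fun x hx =>
      ⟨Set.Ico_subset_Icc_self hx.1, not_not.1 hx.2⟩
  have hid : Integrable (fun t : ℝ => t) periodMeasure :=
    (continuous_id.integrableOn_Icc (a := 0) (b := 2 * Real.pi)).mono_set Set.Ico_subset_Icc_self
  obtain ⟨q, hq, hmom⟩ := exists_moments_eq hF (fun t => hf01 _) hid (trigPoly m) hpos hne
  obtain ⟨N, t, s, h⟩ := exists_alternatesOn (continuous_id.add q.continuous) Real.two_pi_pos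
    ((id_add_trigPoly_zeros_finite hq).subset fun x hx => ⟨Set.Ioo_subset_Icc_self hx.1, hx.2⟩)
  have hN : N ≤ 2 * m + 1 + 1 := h.pred_le fun S hS =>
    id_add_trigPoly_card_zeros_le hq S fun x hx => ⟨Set.Ioo_subset_Icc_self (hS x hx).1,
      (hS x hx).2⟩
  -- With fewer intervals some nonzero r has the sign of t + q; the moments of `f` may be replaced
  -- by those of the sublevel set, so the recession function at r is the integral of -r⁻ + r⁻ = 0.
  have hN' : N = 2 * (m + 1) := by
    by_contra hc
    obtain ⟨r, hr, hr0, hsign⟩ := h.exists_trigPoly (m := m) (by omega)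
    have hK := hpos r hr hr0
    have hi1 := integrable_mul_bcf hF r
    have hi2 := (integrable_bcf (μ := periodMeasure) r).neg.pos_part
    have hi3 : Integrable ({t | t + q t < 0}.indicator (r : ℝ → ℝ)) periodMeasure :=
      (integrable_bcf r).indicator
        (measurableSet_lt (continuous_id.add q.continuous).measurable measurable_const)
    have heq : dualFunctional periodMeasure (fun t => f (Circle.exp t)) 0 r =
        ∫ t, ({t | t + q t < 0}.indicator (r : ℝ → ℝ) t + max ((-r : ℝ → ℝ) t) 0)
          ∂periodMeasure := by
      rw [integral_add hi3 hi2, ← hmom r hr, ← integral_add hi1 hi2, dualFunctional]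
      simp [max_comm]
    have hzero : ∫ t, ({t | t + q t < 0}.indicator (r : ℝ → ℝ) t + max ((-r : ℝ → ℝ) t) 0)
          ∂periodMeasure = 0 := by
      refine integral_eq_zero_of_ae ?_
      filter_upwards [hne q hq, ae_periodMeasure_mem_Ioo] with x hx hx1
      have hs := hsign x hx1
      simp only [Pi.add_apply, id] at hs
      simp only [Pi.neg_apply, Pi.zero_apply]
      rcases lt_or_gt_of_ne hx with hneg | hneg
      · rw [Set.indicator_of_mem (by exact hneg), max_eq_left (by nlinarith)]
        ring
      · rw [Set.indicator_of_notMem (by simpa using hneg.le), max_eq_right (by nlinarith)]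
        ring
    rw [heq, hzero] at hK
    exact lt_irrefl _ hK
  -- With `s = 1` and `N` even, g(0) ≥ 0 ≥ g(2π), contradicting g(2π) = g(0) + 2π.
  have hs : s = -1 := by
    refine h.sign.resolve_left fun hs => ?_
    have hmono := h.strictMono.monotone
    have h1 := h.nonneg 0 h.pos (t 0) ⟨le_rfl, hmono (by omega)⟩
    have h2 := h.nonneg (2 * m + 1) (by omega) (t N)
      ⟨hmono (by omega), hmono (by omega)⟩
    have h3 := trigPoly_add_two_pi hq 0
    rw [h.left] at h1
    rw [h.right] at h2
    rw [zero_add] at h3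
    simp only [hs, Pi.add_apply, id, h3, pow_succ, pow_mul] at h1 h2
    norm_num at h1 h2
    linarith [Real.pi_pos]
  subst hs
  have hmem : ∀ x ∈ Set.Ioo 0 (2 * Real.pi), x + q x ≠ 0 →
      (Circle.exp x ∈ arcUnion (fun r : Fin (m + 1) => t (2 * r)) (fun r => t (2 * r + 1)) ↔
        x + q x < 0) := fun x hx hx0 =>
    h.mem_arcUnion_iff (e := 0) zero_le_one (by norm_num) (by omega) (by omega) hx hx0
  -- The negative intervals have even index; the last arc ends at `t (2 * m + 1)`, strictly before
  -- `t (2 * m + 2)`, which is 2π.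
  refine ⟨_, ⟨fun r => t (2 * r), fun r => t (2 * r + 1), fun r hr => by simp [hr, h.left],
    fun r => h.strictMono (by omega), fun r s hrs => h.strictMono ?_,
    fun r => h.right ▸ h.strictMono (by omega), rfl⟩, fun k hk => ?_⟩
  · have : (r : ℕ) < s := hrs
    omega
  · have hχ : ∀ᵐ x ∂periodMeasure, ∀ y, (arcUnion (fun r : Fin (m + 1) => t (2 * r))
        (fun r => t (2 * r + 1))).indicator (1 : Circle → ℝ) (Circle.exp x) * y =
          {x | x + q x < 0}.indicator (fun _ => y) x := by
      filter_upwards [hne q hq, ae_periodMeasure_mem_Ioo] with x hx0 hx y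
      by_cases hneg : x + q x < 0
      · rw [Set.indicator_of_mem ((hmem x hx hx0).2 hneg), Set.indicator_of_mem (by exact hneg)]
        simp
      · rw [Set.indicator_of_notMem (fun hc => hneg ((hmem x hx hx0).1 hc)),
          Set.indicator_of_notMem (by exact hneg)]
        simp
    have hmoment : ∀ r ∈ trigPoly m, ∫ x, (arcUnion (fun r : Fin (m + 1) => t (2 * r))
        (fun r => t (2 * r + 1))).indicator (1 : Circle → ℝ) (Circle.exp x) * r x
          ∂periodMeasure = ∫ x, f (Circle.exp x) * r x ∂periodMeasure := fun r hr => by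
      rw [hmom r hr]
      refine integral_congr_ae ?_
      filter_upwards [hχ] with x hx
      rw [hx]
      rfl
    refine circleCoeff_eq_of_moments ?_ hF ?_ ?_
    · have : Integrable ({x | x + q x < 0}.indicator (fun _ => (1 : ℝ))) periodMeasure :=
        (integrable_const _).indicator
          (measurableSet_lt (continuous_id.add q.continuous).measurable measurable_const)
      refine this.congr ?_
      filter_upwards [hχ] with x hx
      rw [← hx, mul_one]
    · obtain ⟨c, hc, hce⟩ := cos_mem_trigPoly (Nat.le_of_lt_succ hk)
      simpa only [hce] using hmoment c hc
    · obtain ⟨c, hc, hce⟩ := sin_mem_trigPoly (Nat.le_of_lt_succ hk)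
      simpa only [hce] using hmoment c hc

theorem theorem5 (f : Circle → ℝ) (hf : f ∈ FuzzySubsets) :
    ∃ χ : ℕ → Circle → ℝ, ∀ n : ℕ, 1 ≤ n → ¬ IsArcUnionOfFewerThan n f →
      χ n ∈ CrispSubsets n ∧
        ∀ k : ℕ, k < n → circleCoeff (χ n) k = circleCoeff f k := by
  have hex : ∀ n : ℕ, ∃ χ : Circle → ℝ, 1 ≤ n → ¬ IsArcUnionOfFewerThan n f →
      χ ∈ CrispSubsets n ∧ ∀ k : ℕ, k < n → circleCoeff χ k = circleCoeff f k := by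
    intro n
    by_cases h : 1 ≤ n ∧ ¬ IsArcUnionOfFewerThan n f
    · obtain ⟨m, rfl⟩ := Nat.exists_eq_add_of_le' h.1
      obtain ⟨χ, hχ⟩ := exists_crisp hf m h.2
      exact ⟨χ, fun _ _ => hχ⟩
    · exact ⟨0, fun h1 h2 => absurd ⟨h1, h2⟩ h⟩
  choose χ hχ using hex
  exact ⟨χ, hχ⟩
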